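/- **Setting.** Let $n\ge 3$ be the number of users. User $k\in[n]$ holds the $k$-th row of a matrix $A=(a_{i,j})\in\{0,1\}^{n\times n}$; an undirected simple graph on $[n]$ is identified with its adjacency matrix. Let $\epsilon\ge 0$, $\delta\in[0,1]$, $t\in\{1,\dots,\lfloor n/2\rfloor\}$. The $\epsilon_L$-randomized response maps a bit to itself with probability $\frac{e^{\epsilon_L}}{e^{\epsilon_L}+1}$ and to its complement with probability $q_L=\frac1{e^{\epsilon_L}+1}$. **Local privacy budget.** Let $m=n-2$, and let $\epsilon_L\ge 0$ be such that $\epsilon$ is an upper bound for shuffling with $m$ users of one of the following two kinds. - Closed form: $\delta>0$, $\epsilon_L\le\log\frac{m}{16\log(2/\delta)}$ and $$\epsilon=\log\left(1+\frac{e^{\epsilon_L}-1}{e^{\epsilon_L}+1}\left(\frac{8\sqrt{e^{\epsilon_L}\log(4/\delta)}}{\sqrt m}+\frac{8e^{\epsilon_L}}{m}\right)\right).$$ - Numerical: $\Pr[P\in S]\le e^{\epsilon}\Pr[Q\in S]+\delta$ for all $S\subseteq\mathbb N^2$, where $P=(X+\Delta,\,C-X+1-\Delta)$ and $Q=(X+1-\Delta,\,C-X+\Delta)$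 with $C\sim\mathrm{Bin}(m-1,e^{-\epsilon_L})$, $X\sim\mathrm{Bin}(C,\frac12)$ given $C$, and an independent $\Delta\sim\mathrm{Bern}\big(\frac{e^{\epsilon_L}}{e^{\epsilon_L}+1}\big)$. **Algorithm $\mathsf{WShuffle}_\square$.** The data collector samples a uniformly random permutation $\sigma$ of $[n]$. Independently for each of the disjoint pairs $(i,j)=(\sigma(1),\sigma(2)),(\sigma(3),\sigma(4)),\dots,(\sigma(2t-1),\sigma(2t))$: 1. every user $k\in I_{-(i,j)}=[n]\setminus\{i,j\}$ independently applies $\epsilon_L$-randomized response to the wedge indicator $a_{k,i}a_{k,j}$, giving $y_k$; 2. a shuffler permutes $(y_k)_{k\in I_{-(i,j)}}$ by a uniformly random permutation $\pi$ of $I_{-(i,j)}$ and sends $(y_{\pi(k)})_{k\in I_{-(i,j)}}$ to the data collector; 3. the data collector computes $\hat f^\wedge_{i,j}=\sum_{k\in I_{-(i,j)}}\frac{y_{\pi(k)}-q_L}{1-2q_L}$ and $\hat f^\square_{i,j}=\frac{\hat f^\wedge_{i,j}(\hat f^\wedge_{i,j}-1)}2-\frac{n-2}2\,\frac{q_L(1-q_L)}{(1-2q_L)^2}$.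 The output is $\hat f^\square=\frac{n(n-1)}{4t}\sum_{s=1}^{t}\hat f^\square_{\sigma(2s-1),\sigma(2s)}$. (If $\epsilon_L=0$, then $1-2q_L=0$, and division by $0$ is read as giving $0$.) **Privacy.** A randomized algorithm $\mathcal M$ provides $(\epsilon,\delta)$-element DP if $\Pr[\mathcal M(A)\in S]\le e^{\epsilon}\Pr[\mathcal M(A')\in S]+\delta$ for every set $S$ of outputs and all $A,A'\in\{0,1\}^{n\times n}$ that differ in exactly one entry. It provides $(\epsilon,\delta)$-edge DP if the same inequality holds for the adjacency matrices $A,A'$ of any two undirected graphs on $[n]$ that differ in exactly one edge. **Theorem.** $\mathsf{WShuffle}_\square$ provides $(\epsilon,\delta)$-element DP and $(2\epsilon,2\delta)$-edge DP. The same two guarantees hold for everything that the data collector sees, i.e. for $\sigma$ together with the $t$ families of shuffled noisy wedge indicators. -/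

import Mathlib

noncomputable section

namespace WedgeShuffle

/-! ### Differential privacy -/

/-- `(ε, δ)`-indistinguishability of two discrete distributions, in the direction `p ≤ e^ε q + δ`,
for every set `S` of outputs. -/
def Indist {α : Type} (ε δ : ℝ) (p q : PMF α) : Prop :=
  ∀ S : Set α, p.toOuterMeasure S
    ≤ ENNReal.ofReal (Real.exp ε) * q.toOuterMeasure S + ENNReal.ofReal δ

/-- Two 0/1 matrices that differ in exactly one entry (one bit). -/
def DifferInOneBit {n : ℕ} (A A' : Matrix (Fin n) (Fin n) Bool) : Prop :=
  ∃ a b : Fin n, A a b ≠ A' a b ∧ ∀ c d : Fin n, (c ≠ a ∨ d ≠ b) → A c d = A' c d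

/-- Two undirected graphs on the same vertices whose edge sets differ in exactly one edge. -/
def DifferInOneEdge {n : ℕ} (G G' : SimpleGraph (Fin n)) : Prop :=
  ∃ e : Sym2 (Fin n), symmDiff G.edgeSet G'.edgeSet = {e}

open Classical in
/-- The adjacency matrix `(a_{i,j})` of an undirected graph, with entries in `Bool = {0,1}`. -/
def adjacency {n : ℕ} (G : SimpleGraph (Fin n)) : Matrix (Fin n) (Fin n) Bool :=
  fun i j => decide (G.Adj i j)

/-- `(ε, δ)`-element DP: neighbouring inputs are 0/1 matrices that differ in one bit. The row `i`
of the matrix is the neighbour list held by user `i`; as two symmetric matrices with zero diagonal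
cannot differ in exactly one bit, the matrices are not required to be symmetric. -/
def ElementDP {n : ℕ} {α : Type} (M : Matrix (Fin n) (Fin n) Bool → PMF α) (ε δ : ℝ) : Prop :=
  ∀ A A' : Matrix (Fin n) (Fin n) Bool, DifferInOneBit A A' → Indist ε δ (M A) (M A')

/-- `(ε, δ)`-edge DP: neighbouring inputs are undirected graphs that differ in one edge. -/
def EdgeDP {n : ℕ} {α : Type} (M : Matrix (Fin n) (Fin n) Bool → PMF α) (ε δ : ℝ) : Prop :=
  ∀ G G' : SimpleGraph (Fin n), DifferInOneEdge G G' →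
    Indist ε δ (M (adjacency G)) (M (adjacency G'))

/-! ### Basic random choices -/

/-- The joint distribution of independent draws, the `i`-th from `p i`. -/
def indep {ι : Type} [Fintype ι] [DecidableEq ι] {α : ι → Type} [∀ i, Fintype (α i)]
    (p : ∀ i, PMF (α i)) : PMF (∀ i, α i) :=
  PMF.ofFintype (fun f => ∏ i, p i (f i)) (by
    have h := Finset.prod_univ_sum (fun i => (Finset.univ : Finset (α i))) (fun i a => p i a)
    rw [Fintype.piFinset_univ] at h
    rw [← h]
    refine Finset.prod_eq_one fun i _ => ?_
    rw [← tsum_fintype (L := .unconditional _)]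
    exact (p i).tsum_coe)

/-- Warner's randomized response with parameter `ε`: the bit is kept with probability
`e^ε / (e^ε + 1)` and flipped with probability `1 / (e^ε + 1)`. -/
def warnerRR (ε : ℝ) (x : Bool) : PMF Bool :=
  PMF.ofFintype
    (fun y => ENNReal.ofReal
      (if x = y then Real.exp ε / (Real.exp ε + 1) else 1 / (Real.exp ε + 1))) (by
    have h : (0 : ℝ) < Real.exp ε := Real.exp_pos ε
    have h1 : (0 : ℝ) ≤ Real.exp ε / (Real.exp ε + 1) := by positivity
    have h2 : (0 : ℝ) ≤ 1 / (Real.exp ε + 1) := by positivity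
    have h3 : Real.exp ε / (Real.exp ε + 1) + 1 / (Real.exp ε + 1) = 1 := by
      field_simp
    cases x
    · simp only [Fintype.sum_bool, Bool.false_eq_true, if_true, if_false]
      rw [← ENNReal.ofReal_add h2 h1, add_comm, h3, ENNReal.ofReal_one]
    · simp only [Fintype.sum_bool, Bool.true_eq_false, if_true, if_false]
      rw [← ENNReal.ofReal_add h1 h2, h3, ENNReal.ofReal_one])

/-- A coin that shows `true` with probability `p`. -/
def coin (p : ℝ) (h0 : 0 ≤ p) (h1 : p ≤ 1) : PMF Bool :=
  PMF.ofFintype (fun b => ENNReal.ofReal (if b then p else 1 - p)) (by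
    simp only [Fintype.sum_bool, Bool.false_eq_true, if_true, if_false]
    rw [← ENNReal.ofReal_add h0 (by linarith), add_sub_cancel, ENNReal.ofReal_one])

/-- The binomial distribution `Bin(N, p)`: the number of successes in `N` independent coins. -/
def binom (N : ℕ) (p : ℝ) (h0 : 0 ≤ p) (h1 : p ≤ 1) : PMF ℕ :=
  (indep fun _ : Fin N => coin p h0 h1).map fun b => (Finset.univ.filter fun i => b i = true).card

/-! ### The local privacy budget -/

/-- The closed-form privacy amplification bound `f(m, ε_L, δ)` for `m` users. -/
def amplification (m : ℕ) (εL δ : ℝ) : ℝ :=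
  Real.log (1 + (Real.exp εL - 1) / (Real.exp εL + 1) *
    (8 * √(Real.exp εL * Real.log (4 / δ)) / √(m : ℝ) + 8 * Real.exp εL / (m : ℝ)))

/-- `ε` is the closed-form bound for `m` shuffled reports with local budget `ε_L`, and `ε_L` lies in
the range `ε_L ≤ log (m / (16 log (2/δ)))` on which this bound is asserted. -/
def IsClosedFormBound (m : ℕ) (ε δ εL : ℝ) : Prop :=
  0 < δ ∧ εL ≤ Real.log ((m : ℝ) / (16 * Real.log (2 / δ))) ∧ ε = amplification m εL δ

/-- The pair of distributions on which the numerical privacy amplification bound is computed: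
with `C ∼ Bin(m-1, e^{-ε_L})`, `A ∼ Bin(C, 1/2)` and `Δ ∼ Bern(e^{ε_L} / (e^{ε_L} + 1))`, it is
the law of `(A + Δ, C - A + 1 - Δ)` for `b = true` and of `(A + 1 - Δ, C - A + Δ)` for
`b = false`. -/
def clonePair (m : ℕ) (εL : ℝ) (hL : 0 ≤ εL) (b : Bool) : PMF (ℕ × ℕ) :=
  (binom (m - 1) (Real.exp (-εL)) (Real.exp_pos _).le
      (Real.exp_le_one_iff.mpr (neg_nonpos.mpr hL))).bind fun C =>
    (binom C (1 / 2) (by norm_num) (by norm_num)).bind fun A =>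
      (warnerRR εL b).map fun Δ =>
        if Δ then (A + 1, C - A) else (A, C - A + 1)

/-- `ε` is a numerical upper bound for `m` shuffled reports with local budget `ε_L`: the
hockey-stick divergence of order `e^ε` of the pair above is at most `δ`. -/
def IsNumericalBound (m : ℕ) (ε δ εL : ℝ) : Prop :=
  ∃ hL : 0 ≤ εL, Indist ε δ (clonePair m εL hL true) (clonePair m εL hL false)

/-- `ε_L` is a value that `LocalPrivacyBudget(n, ε, δ)` may return: `ε` is a closed-form or a
numerical upper bound in the shuffle model with `n - 2` users. -/
def IsLocalPrivacyBudget (n : ℕ) (ε δ εL : ℝ) : Prop :=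
  0 ≤ εL ∧ (IsClosedFormBound (n - 2) ε δ εL ∨ IsNumericalBound (n - 2) ε δ εL)

/-! ### Wedge shuffling -/

/-- The index set `[n] \ {i, j}`. -/
abbrev Others {n : ℕ} (i j : Fin n) : Type := {k : Fin n // k ≠ i ∧ k ≠ j}

/-- The wedge indicator `w_{i-k-j} = a_{k,i} a_{k,j}`, computed by user `k`. -/
def wedge {n : ℕ} (A : Matrix (Fin n) (Fin n) Bool) (i j k : Fin n) : Bool := A k i && A k j

/-- The algorithm `WS`: every user `k ≠ i, j` applies randomized response to her wedge indicator,
independently of the others, and the shuffler permutes the reports uniformly at random. -/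
def WS {n : ℕ} (A : Matrix (Fin n) (Fin n) Bool) (εL : ℝ) (i j : Fin n) :
    PMF (Others i j → Bool) :=
  (indep fun k : Others i j => warnerRR εL (wedge A i j k)).bind fun y =>
    (PMF.uniformOfFintype (Equiv.Perm (Others i j))).map fun π => fun k => y (π k)

/-! ### The 4-cycle algorithm -/

/-- The position of the first member of the `s`-th pair (`s = 0, …, t - 1`) in the permutation. -/
def fstPos {n t : ℕ} (ht : t ≤ n / 2) (s : Fin t) : Fin n :=
  ⟨2 * (s : ℕ), by have := s.isLt; omega⟩

/-- The position of the second member of the `s`-th pair. -/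
def sndPos {n t : ℕ} (ht : t ≤ n / 2) (s : Fin t) : Fin n :=
  ⟨2 * (s : ℕ) + 1, by have := s.isLt; omega⟩

/-- What the data collector sees: the permutation `σ` that she sampled, and for each of the `t`
user-pairs the shuffled noisy wedge indicators. -/
abbrev View (n t : ℕ) (ht : t ≤ n / 2) : Type :=
  (σ : Equiv.Perm (Fin n)) × ((s : Fin t) → Others (σ (fstPos ht s)) (σ (sndPos ht s)) → Bool)

/-- The part of the algorithm that accesses the data: sample `σ` uniformly, then run `WS`
independently on the `t` disjoint user-pairs that `σ` determines. -/
def collectorView {n t : ℕ} (ht : t ≤ n / 2) (εL : ℝ) (A : Matrix (Fin n) (Fin n) Bool) :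
    PMF (View n t ht) :=
  (PMF.uniformOfFintype (Equiv.Perm (Fin n))).bind fun σ =>
    (indep fun s : Fin t => WS A εL (σ (fstPos ht s)) (σ (sndPos ht s))).map fun y => ⟨σ, y⟩

/-- The flip probability `q_L = 1 / (e^{ε_L} + 1)`. -/
def flipProb (εL : ℝ) : ℝ := 1 / (Real.exp εL + 1)

/-- The wedge estimate `∑_k (y_k - q_L) / (1 - 2 q_L)`. -/
def wedgeEstimate {ι : Type} [Fintype ι] (q : ℝ) (y : ι → Bool) : ℝ :=
  ∑ k, ((if y k then (1 : ℝ) else 0) - q) / (1 - 2 * q)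

/-- The bias-corrected 4-cycle estimate of one user-pair, from its wedge estimate `w`. -/
def pairEstimate (n : ℕ) (q w : ℝ) : ℝ :=
  w * (w - 1) / 2 - ((n : ℝ) - 2) / 2 * (q * (1 - q) / (1 - 2 * q) ^ 2)

/-- The 4-cycle estimate that the data collector computes from what she sees. -/
def estimate {n t : ℕ} {ht : t ≤ n / 2} (εL : ℝ) (v : View n t ht) : ℝ :=
  (n : ℝ) * ((n : ℝ) - 1) / (4 * (t : ℝ)) *
    ∑ s : Fin t, pairEstimate n (flipProb εL) (wedgeEstimate (flipProb εL) (v.2 s))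

/-- The 4-cycle counting algorithm, as a map from 0/1 matrices to distributions of the estimate. -/
def WShuffleSquare {n t : ℕ} (ht : t ≤ n / 2) (εL : ℝ) (A : Matrix (Fin n) (Fin n) Bool) :
    PMF ℝ :=
  (collectorView ht εL A).map (estimate εL)

end WedgeShuffle

end

open scoped ENNReal

/-!
The view of the data collector is a mixture, over `σ`, of `t` independent runs of the wedge
shuffler, and the estimate is a post-processing of the view, so it suffices to treat the view for a
fixed `σ`. The pairs are disjoint, so the entry `(a, b)` of the matrix enters only the run for the
pair that contains `b`, and there only the report of user `a` (`elementDP_collectorView`). An edge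
`{a, b}` consists of the entries `(a, b)` and `(b, a)`. If `a` and `b` lie in different pairs, each
of two independent runs changes in the report of one user, and composition (`Indist.comp`) gives
`(2ε, 2δ)` rather than the weaker bound of group privacy. If they form one pair, neither of them
reports in its run, and the edge is not used at all (`edgeDP_collectorView`).

Everything thus rests on privacy amplification for one run (`indist_shuffle`): `m = n - 2` users
apply randomized response, the reports are shuffled, and the input of one user changes while the
other inputs are arbitrary. A shuffled vector of bits carries no more information than its number
of `true`s. Each of the other users is a *clone* with probability `p = e^{-ε_L}`, and then outputs
a fair coin independently of her input (`exists_warnerRR_eq_bind`). Given the number `C` of clones,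
the contribution of the clones is `Bin(C, 1/2)`, independent of the contribution of the other
users. The latter can therefore be simulated from `C` alone, so the number of `true`s is a
post-processing of `clonePair` (`exists_countLaw_eq_clonePair_bind`), which settles the case of the
numerical bound.

The closed-form bound is reduced to the numerical one (`IsClosedFormBound.isNumericalBound`). Write
`e = e^{ε_L}` and `M = m p`. Given `C`, the two laws of clone counts have the likelihood ratio
`(a + 1) / (C - a)`. By Hoeffding's inequality it exceeds `1 + γ`, where
`γ = 8 √(log(4/δ)/M) + 8/M`, with probability at most `δ/2` when `C ≥ M/2`, and by Chernoff's
inequality `C < M/2` has probability at most `δ/2`. The random bit `Δ` of the distinguished user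
mixes the two laws, which replaces `γ` by `(e - 1)/(e + 1) · γ` (`mixture_contraction`).
-/

noncomputable section

namespace WedgeShuffle

/-! ### Indistinguishability: test functions, composition, mixtures -/

/-- The hockey-stick divergence of order `e^ε` is at most `δ`; `-` is truncated subtraction, i.e.
the positive part. -/
theorem Indist.tsum_tsub_le {α : Type} {ε δ : ℝ} {p q : PMF α} (h : Indist ε δ p q) :
    ∑' a, (p a - ENNReal.ofReal (Real.exp ε) * q a) ≤ ENNReal.ofReal δ := by
  set c := ENNReal.ofReal (Real.exp ε) with hc
  let S : Set α := {a | c * q a < p a}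
  have key : ∑' a, (p a - c * q a) + c * q.toOuterMeasure S = p.toOuterMeasure S := by
    rw [PMF.toOuterMeasure_apply, PMF.toOuterMeasure_apply, ← ENNReal.tsum_mul_left,
      ← ENNReal.tsum_add]
    refine tsum_congr fun a => ?_
    by_cases ha : a ∈ S
    · rw [Set.indicator_of_mem ha, Set.indicator_of_mem ha, tsub_add_cancel_of_le (le_of_lt ha)]
    · rw [Set.indicator_of_notMem ha, Set.indicator_of_notMem ha, mul_zero, add_zero]
      exact tsub_eq_zero_of_le (not_lt.mp ha)
  have hfin : c * q.toOuterMeasure S ≠ ⊤ := by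
    refine ENNReal.mul_ne_top ENNReal.ofReal_ne_top (ne_top_of_le_ne_top ENNReal.one_ne_top ?_)
    rw [PMF.toOuterMeasure_apply, ← q.tsum_coe]
    exact ENNReal.tsum_le_tsum fun a => Set.indicator_le_self _ _ a
  have hS := h S
  rw [← key, add_comm] at hS
  exact (ENNReal.add_le_add_iff_left hfin).mp hS

/-- Indistinguishability passes from sets to randomized tests, i.e. functions with values
in `[0, 1]`. -/
theorem Indist.tsum_mul_le {α : Type} {ε δ : ℝ} {p q : PMF α} (h : Indist ε δ p q)
    (g : α → ℝ≥0∞) (hg : ∀ a, g a ≤ 1) :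
    ∑' a, p a * g a ≤
      ENNReal.ofReal (Real.exp ε) * ∑' a, q a * g a + ENNReal.ofReal δ := by
  set c := ENNReal.ofReal (Real.exp ε) with hc
  calc ∑' a, p a * g a ≤ ∑' a, (c * (q a * g a) + (p a - c * q a)) := by
        refine ENNReal.tsum_le_tsum fun a => ?_
        calc p a * g a ≤ (c * q a + (p a - c * q a)) * g a :=
              mul_le_mul_left (le_add_tsub) _
          _ = c * (q a * g a) + (p a - c * q a) * g a := by ring
          _ ≤ _ := by
              gcongr
              exact mul_le_of_le_one_right' (hg a)
    _ = c * ∑' a, q a * g a + ∑' a, (p a - c * q a) := by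
        rw [ENNReal.tsum_add, ENNReal.tsum_mul_left]
    _ ≤ _ := by gcongr; exact h.tsum_tsub_le

theorem toOuterMeasure_le_one {α : Type} (p : PMF α) (S : Set α) : p.toOuterMeasure S ≤ 1 := by
  rw [PMF.toOuterMeasure_apply, ← p.tsum_coe]
  exact ENNReal.tsum_le_tsum fun a => Set.indicator_le_self _ _ a

theorem Indist.refl {α : Type} {ε δ : ℝ} (hε : 0 ≤ ε) (p : PMF α) : Indist ε δ p p := fun S => by
  have h1 : 1 ≤ ENNReal.ofReal (Real.exp ε) := by
    rw [← ENNReal.ofReal_one]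
    exact ENNReal.ofReal_le_ofReal (Real.one_le_exp hε)
  exact (le_mul_of_one_le_left' h1).trans le_self_add

theorem Indist.mono {α : Type} {ε ε' δ δ' : ℝ} (hε : ε ≤ ε') (hδ : δ ≤ δ') {p q : PMF α}
    (h : Indist ε δ p q) : Indist ε' δ' p q := fun S =>
  (h S).trans (by gcongr)

/-- Adaptive composition: the two privacy budgets add up. -/
theorem Indist.comp {α β : Type} {ε₁ ε₂ δ₁ δ₂ : ℝ} (hδ₁ : 0 ≤ δ₁) (hδ₂ : 0 ≤ δ₂) {p q : PMF α}
    {κ η : α → PMF β} (h₁ : Indist ε₁ δ₁ p q) (h₂ : ∀ a, Indist ε₂ δ₂ (κ a) (η a)) :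
    Indist (ε₁ + ε₂) (δ₁ + δ₂) (p.bind κ) (q.bind η) := fun S => by
  rw [PMF.toOuterMeasure_bind_apply, PMF.toOuterMeasure_bind_apply, Real.exp_add,
    ENNReal.ofReal_mul (Real.exp_pos _).le, ENNReal.ofReal_add hδ₁ hδ₂]
  set c₁ := ENNReal.ofReal (Real.exp ε₁)
  set c₂ := ENNReal.ofReal (Real.exp ε₂)
  -- Capping the conditional bound at 1 before adding `δ₂` keeps the factor `c₁` off `δ₂`.
  let g : α → ℝ≥0∞ := fun a => min 1 (c₂ * (η a).toOuterMeasure S)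
  calc ∑' a, p a * (κ a).toOuterMeasure S
      ≤ ∑' a, (p a * g a + p a * ENNReal.ofReal δ₂) := by
        refine ENNReal.tsum_le_tsum fun a => ?_
        rw [← mul_add]
        gcongr
        change _ ≤ min _ _ + _
        rw [min_add_add_right 1 _ (ENNReal.ofReal δ₂) |>.symm]
        exact le_min ((toOuterMeasure_le_one _ _).trans le_self_add) (h₂ a S)
    _ = ∑' a, p a * g a + ENNReal.ofReal δ₂ := by
        rw [ENNReal.tsum_add, ENNReal.tsum_mul_right, p.tsum_coe, one_mul]
    _ ≤ c₁ * ∑' a, q a * g a + ENNReal.ofReal δ₁ + ENNReal.ofReal δ₂ := by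
        gcongr
        exact h₁.tsum_mul_le g fun a => min_le_left _ _
    _ ≤ c₁ * ∑' a, q a * (c₂ * (η a).toOuterMeasure S) + ENNReal.ofReal δ₁
          + ENNReal.ofReal δ₂ := by
        gcongr
        exact min_le_right _ _
    _ = _ := by
        simp_rw [mul_left_comm (q _) c₂, ENNReal.tsum_mul_left]
        ring

/-- Post-processing. -/
theorem Indist.bind {α β : Type} {ε δ : ℝ} {p q : PMF α} (h : Indist ε δ p q)
    (κ : α → PMF β) : Indist ε δ (p.bind κ) (q.bind κ) := fun S => by
  rw [PMF.toOuterMeasure_bind_apply, PMF.toOuterMeasure_bind_apply]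
  exact h.tsum_mul_le _ fun a => toOuterMeasure_le_one _ _

theorem Indist.map {α β : Type} {ε δ : ℝ} {p q : PMF α} (h : Indist ε δ p q)
    (f : α → β) : Indist ε δ (p.map f) (q.map f) :=
  h.bind _

/-- Mixtures with common weights. -/
theorem Indist.mixture {α β : Type} {ε δ : ℝ} (p : PMF α) {κ η : α → PMF β}
    (h : ∀ a, Indist ε δ (κ a) (η a)) : Indist ε δ (p.bind κ) (p.bind η) := fun S => by
  rw [PMF.toOuterMeasure_bind_apply, PMF.toOuterMeasure_bind_apply]
  calc ∑' a, p a * (κ a).toOuterMeasure S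
      ≤ ∑' a, (ENNReal.ofReal (Real.exp ε) * (p a * (η a).toOuterMeasure S)
          + p a * ENNReal.ofReal δ) := by
        refine ENNReal.tsum_le_tsum fun a => ?_
        rw [mul_left_comm, ← mul_add]
        gcongr
        exact h a S
    _ = _ := by
        rw [ENNReal.tsum_add, ENNReal.tsum_mul_left, ENNReal.tsum_mul_right, p.tsum_coe, one_mul]

/-! ### Independent families -/

section Indep

variable {ι : Type} [Fintype ι] [DecidableEq ι] {α : ι → Type} [∀ i, Fintype (α i)]

theorem indep_apply (p : ∀ i, PMF (α i)) (f : ∀ i, α i) : indep p f = ∏ i, p i (f i) := rfl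

open Classical in
/-- The law of an independent family with the coordinate `i` overwritten by `a`. -/
theorem indep_map_update_apply (p : ∀ i, PMF (α i)) (i : ι) (a : α i) (f : ∀ i, α i) :
    (indep p).map (fun y => Function.update y i a) f =
      if f i = a then ∏ j ∈ Finset.univ.erase i, p j (f j) else 0 := by
  rw [PMF.map_apply, tsum_fintype]
  split_ifs with hf
  · have hinj : Function.Injective fun b : α i => Function.update f i b := fun b c h => by
      simpa using congrFun h i
    have hterm : ∀ b : α i, indep p (Function.update f i b) =
        p i b * ∏ j ∈ Finset.univ.erase i, p j (f j) := fun b => by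
      rw [indep_apply, ← Finset.mul_prod_erase _ _ (Finset.mem_univ i),
        Function.update_self]
      congr 1
      refine Finset.prod_congr rfl fun j hj => ?_
      rw [Function.update_of_ne (Finset.ne_of_mem_erase hj)]
    have hset : (Finset.univ.filter fun y : ∀ i, α i => f = Function.update y i a) =
        Finset.univ.image fun b : α i => Function.update f i b := by
      ext y
      simp only [Finset.mem_filter, Finset.mem_univ, true_and, Finset.mem_image]
      constructor
      · intro h
        exact ⟨y i, by rw [h]; simp⟩
      · rintro ⟨b, rfl⟩
        rw [← hf]; simp
    trans ∑ y ∈ Finset.univ.filter fun y : ∀ i, α i => f = Function.update y i a, indep p y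
    · rw [Finset.sum_filter]
      exact Finset.sum_congr rfl fun y _ => by congr
    rw [hset, Finset.sum_image fun b _ c _ h => hinj h]
    simp_rw [hterm]
    rw [← Finset.sum_mul, ← tsum_fintype (L := .unconditional _), (p i).tsum_coe, one_mul]
  · refine Finset.sum_eq_zero fun y _ => if_neg fun h => hf ?_
    rw [h, Function.update_self]

/-- The coordinate `i` of an independent family may be drawn first. -/
theorem indep_eq_bind_update (p : ∀ i, PMF (α i)) (i : ι) :
    indep p = (p i).bind fun a => (indep p).map fun y => Function.update y i a := by
  ext f
  rw [PMF.bind_apply, tsum_eq_single (f i)]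
  · rw [indep_map_update_apply, if_pos rfl, indep_apply,
      Finset.mul_prod_erase _ (fun j => p j (f j)) (Finset.mem_univ i)]
  · intro a ha
    rw [indep_map_update_apply, if_neg ha.symm, mul_zero]

theorem indep_map_update_congr {p q : ∀ i, PMF (α i)} {i : ι} (h : ∀ j, j ≠ i → p j = q j)
    (a : α i) : ((indep p).map fun y => Function.update y i a) =
      (indep q).map fun y => Function.update y i a := by
  ext f
  rw [indep_map_update_apply, indep_map_update_apply]
  congr 1
  exact Finset.prod_congr rfl fun j hj => by rw [h j (Finset.ne_of_mem_erase hj)]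

theorem indist_indep_of_eq_off {ε δ : ℝ} {p q : ∀ i, PMF (α i)} (i : ι)
    (h : ∀ j, j ≠ i → p j = q j) (hi : Indist ε δ (p i) (q i)) :
    Indist ε δ (indep p) (indep q) := by
  rw [indep_eq_bind_update p i, indep_eq_bind_update q i]
  simp_rw [indep_map_update_congr h]
  exact hi.bind _

theorem indist_indep_of_eq_off_two {ε δ : ℝ} (hε : 0 ≤ ε) (hδ : 0 ≤ δ) {p q : ∀ i, PMF (α i)}
    (i j : ι) (h : ∀ k, k ≠ i → k ≠ j → p k = q k) (hi : Indist ε δ (p i) (q i))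
    (hj : Indist ε δ (p j) (q j)) : Indist (2 * ε) (2 * δ) (indep p) (indep q) := by
  by_cases hij : i = j
  · subst hij
    exact (indist_indep_of_eq_off i (fun k hk => h k hk hk) hi).mono (by linarith) (by linarith)
  · rw [two_mul, two_mul, indep_eq_bind_update p i, indep_eq_bind_update q i]
    refine hi.comp hδ hδ fun a => ?_
    -- The hybrid family agrees with `p` off `i`, and with `q` off `j`.
    rw [indep_map_update_congr (q := Function.update p i (q i))
      (fun k hk => by rw [Function.update_of_ne hk]) a]
    refine (indist_indep_of_eq_off j (fun k hk => ?_) ?_).map _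
    · by_cases hki : k = i
      · subst hki; simp
      · rw [Function.update_of_ne hki, h k hki hk]
    · rwa [Function.update_of_ne (Ne.symm hij)]

end Indep

/-! ### Number of successes -/

/-- The law of the number of `true`s among independent bits with the listed laws. -/
def countLaw : List (PMF Bool) → PMF ℕ
  | [] => PMF.pure 0
  | p :: l => p.bind fun b => (countLaw l).map fun c => b.toNat + c

theorem indep_map_sum_eq_countLaw {ι : Type} [Fintype ι] [DecidableEq ι] (p : ι → PMF Bool)
    (l : List ι) (hl : l.Nodup) :
    ((indep p).map fun y => (l.map fun k => (y k).toNat).sum) = countLaw (l.map p) := by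
  induction l with
  | nil => simp only [List.map_nil, List.sum_nil, countLaw]; exact PMF.map_const _ _
  | cons i l ih =>
    rw [List.nodup_cons] at hl
    rw [indep_eq_bind_update p i, PMF.map_bind, List.map_cons, countLaw, ← ih hl.2]
    congr 1
    funext b
    rw [PMF.map_comp, PMF.map_comp]
    congr 1
    funext y
    have hmap : (l.map fun k => (Function.update y i b k).toNat) = l.map fun k => (y k).toNat :=
      List.map_congr_left fun k hk => by
        rw [Function.update_of_ne (by rintro rfl; exact hl.1 hk)]
    simp only [Function.comp, List.map_cons, List.sum_cons, Function.update_self, hmap]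

theorem card_filter_eq_sum_toNat {ι : Type} [Fintype ι] (y : ι → Bool) :
    (Finset.univ.filter fun i => y i = true).card =
      (Finset.univ.toList.map fun k => (y k).toNat).sum := by
  rw [Finset.sum_map_toList, Finset.card_filter]
  exact Finset.sum_congr rfl fun i _ => by cases y i <;> rfl

theorem binom_eq_countLaw (N : ℕ) (p : ℝ) (h0 : 0 ≤ p) (h1 : p ≤ 1) :
    binom N p h0 h1 = countLaw (List.replicate N (coin p h0 h1)) := by
  unfold binom
  simp_rw [card_filter_eq_sum_toNat]
  rw [indep_map_sum_eq_countLaw _ _ (Finset.nodup_toList _), List.map_const', Finset.length_toList,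
    Finset.card_univ, Fintype.card_fin]

theorem binom_zero (p : ℝ) (h0 : 0 ≤ p) (h1 : p ≤ 1) : binom 0 p h0 h1 = PMF.pure 0 := by
  rw [binom_eq_countLaw]; rfl

theorem binom_succ (N : ℕ) (p : ℝ) (h0 : 0 ≤ p) (h1 : p ≤ 1) :
    binom (N + 1) p h0 h1 =
      (coin p h0 h1).bind fun b => (binom N p h0 h1).map fun c => b.toNat + c := by
  rw [binom_eq_countLaw, binom_eq_countLaw, List.replicate_succ, countLaw]

/-! ### Decomposition of the reports into clones and leftovers -/

theorem bind_congr_of_apply_ne_zero {α β : Type} (p : PMF α) {f g : α → PMF β}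
    (h : ∀ a, p a ≠ 0 → f a = g a) : p.bind f = p.bind g := by
  ext b
  rw [PMF.bind_apply, PMF.bind_apply]
  refine tsum_congr fun a => ?_
  by_cases ha : p a = 0
  · rw [ha, zero_mul, zero_mul]
  · rw [h a ha]

theorem warnerRR_apply (ε : ℝ) (x y : Bool) : warnerRR ε x y = ENNReal.ofReal
      (if x = y then Real.exp ε / (Real.exp ε + 1) else 1 / (Real.exp ε + 1)) := rfl

theorem coin_apply (p : ℝ) (h0 : 0 ≤ p) (h1 : p ≤ 1) (b : Bool) :
    coin p h0 h1 b = ENNReal.ofReal (if b then p else 1 - p) := rfl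

/-- Flipping the input of randomized response flips its output. -/
theorem warnerRR_not (ε : ℝ) (x : Bool) : warnerRR ε (!x) = (warnerRR ε x).map not := by
  ext y
  rw [PMF.map_apply, tsum_bool]
  cases x <;> cases y <;> simp [warnerRR_apply]

/-- A fair coin. -/
abbrev fairCoin : PMF Bool := coin (1 / 2) (by norm_num) (by norm_num)

/-- With probability `e^{-ε}` randomized response forgets its input and outputs a fair coin. -/
theorem exists_warnerRR_eq_bind (ε : ℝ) (hε : 0 ≤ ε) : ∃ L : Bool → PMF Bool, ∀ x,
    warnerRR ε x = (coin (Real.exp (-ε)) (Real.exp_pos _).le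
      (Real.exp_le_one_iff.mpr (neg_nonpos.mpr hε))).bind fun f =>
        if f then fairCoin else L x := by
  have he : 1 ≤ Real.exp ε := Real.one_le_exp hε
  set e := Real.exp ε with hedef
  have hinv : Real.exp (-ε) = e⁻¹ := Real.exp_neg ε
  -- `v` is the conditional probability that a non-clone report is truthful.
  obtain ⟨v, hv0, hv1, hv⟩ : ∃ v : ℝ, 0 ≤ v ∧ v ≤ 1 ∧
      e / (e + 1) = e⁻¹ * (1 / 2) + (1 - e⁻¹) * v := by
    rcases he.eq_or_lt with h | h
    · exact ⟨0, le_rfl, zero_le_one, by rw [← h]; norm_num⟩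
    · have h1 : 0 < e - 1 := by linarith
      refine ⟨(2 * e + 1) / (2 * (e + 1)), by positivity, ?_, ?_⟩
      · rw [div_le_one (by positivity)]; linarith
      · field_simp; ring
  have hv' : 1 / (e + 1) = e⁻¹ * (1 / 2) + (1 - e⁻¹) * (1 - v) := by
    have : 1 / (e + 1) = 1 - e / (e + 1) := by field_simp; ring
    rw [this, hv]; ring
  have hi0 : 0 ≤ e⁻¹ := by positivity
  have hi1 : 0 ≤ 1 - e⁻¹ := sub_nonneg.mpr (inv_le_one_of_one_le₀ he)
  refine ⟨fun x => coin (if x then v else 1 - v) (by split_ifs <;> linarith)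
    (by split_ifs <;> linarith), fun x => ?_⟩
  ext y
  rw [PMF.bind_apply, tsum_bool]
  simp only [coin_apply, warnerRR_apply, hinv, ← hedef, if_true, Bool.false_eq_true, if_false]
  have h12 : (0 : ℝ) ≤ 1 - 1 / 2 := by norm_num
  have hv1' : 0 ≤ 1 - v := by linarith
  cases x <;> cases y <;>
    simp only [if_true, Bool.false_eq_true, Bool.true_eq_false, if_false] <;>
    rw [← ENNReal.ofReal_mul (by positivity), ← ENNReal.ofReal_mul (by positivity),
      ← ENNReal.ofReal_add (mul_nonneg hi1 (by linarith)) (mul_nonneg hi0 (by norm_num))] <;>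
    congr 1 <;> linarith

/-- The joint law of the number of clones and of the number of `true`s among the leftover reports,
when user `x` of the list is a clone with law `f`, and has the leftover law `L x` otherwise. -/
def cloneLaw (f : PMF Bool) (L : Bool → PMF Bool) : List Bool → PMF (ℕ × ℕ)
  | [] => PMF.pure (0, 0)
  | x :: xs => f.bind fun b => if b then (cloneLaw f L xs).map fun d => (1 + d.1, d.2)
      else (L x).bind fun y => (cloneLaw f L xs).map fun d => (d.1, y.toNat + d.2)

theorem cloneLaw_map_fst (f : PMF Bool) (L : Bool → PMF Bool) (xs : List Bool) :
    (cloneLaw f L xs).map Prod.fst = countLaw (List.replicate xs.length f) := by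
  induction xs with
  | nil => exact PMF.pure_map _ _
  | cons x xs ih =>
    rw [List.length_cons, List.replicate_succ, countLaw, cloneLaw, PMF.map_bind, ← ih]
    congr 1
    funext b
    cases b
    · simp only [Bool.false_eq_true, if_false, PMF.map_bind, PMF.map_comp, Bool.toNat_false,
        zero_add]
      exact PMF.bind_const (L x) ((cloneLaw f L xs).map Prod.fst)
    · simp only [if_true, PMF.map_comp, Bool.toNat_true]
      rfl

/-- The number of `true` reports is the number of `true`s among the leftovers plus a number of
successes of as many fair coins as there are clones. -/
theorem countLaw_eq_cloneLaw_bind (f : PMF Bool) (L R : Bool → PMF Bool)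
    (hR : ∀ x, R x = f.bind fun b => if b then fairCoin else L x) (xs : List Bool) :
    countLaw (xs.map R) = (cloneLaw f L xs).bind fun d =>
      (countLaw (List.replicate d.1 fairCoin)).map fun a => a + d.2 := by
  induction xs with
  | nil =>
    rw [List.map_nil, cloneLaw, PMF.pure_bind]
    exact (PMF.pure_map (fun a => a + 0) 0).symm
  | cons x xs ih =>
    rw [List.map_cons, countLaw, hR, cloneLaw, PMF.bind_bind, PMF.bind_bind, ih]
    congr 1
    funext b
    cases b
    · simp only [Bool.false_eq_true, if_false, PMF.bind_bind, PMF.bind_map, PMF.map_bind,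
        PMF.map_comp]
      congr 1
      funext y
      congr 1
      funext d
      simp only [Function.comp]
      congr 1
      funext a
      simp only [Function.comp]
      omega
    · simp only [if_true, PMF.bind_map, PMF.map_bind, PMF.map_comp]
      rw [PMF.bind_comm]
      congr 1
      funext d
      simp only [Function.comp]
      rw [add_comm 1 d.1, List.replicate_succ, countLaw, PMF.map_bind]
      congr 1
      funext y
      rw [PMF.map_comp]
      congr 1
      funext a
      simp only [Function.comp]
      omega

/-- Disintegration of a discrete joint law along its first coordinate. -/
theorem exists_disintegration {α β : Type} (J : PMF (α × β)) : ∃ κ : α → PMF β,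
    J = (J.map Prod.fst).bind fun a => (κ a).map fun b => (a, b) := by
  classical
  have hmarg : ∀ a, J.map Prod.fst a = ∑' b, J (a, b) := fun a => by
    rw [PMF.map_apply, ENNReal.tsum_prod', tsum_eq_single a]
    · simp
    · intro a' ha'
      simp [ha'.symm]
  obtain ⟨⟨_, b₀⟩, _⟩ := J.support_nonempty
  have hex : ∀ a, ∃ k : PMF β, ∀ b, J (a, b) = J.map Prod.fst a * k b := fun a => by
    by_cases h0 : ∑' b, J (a, b) = 0
    · refine ⟨PMF.pure b₀, fun b => ?_⟩
      rw [hmarg, h0, zero_mul]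
      exact ENNReal.tsum_eq_zero.mp h0 b
    · have htop : ∑' b, J (a, b) ≠ ⊤ := by rw [← hmarg]; exact PMF.apply_ne_top _ _
      refine ⟨PMF.normalize (fun b => J (a, b)) h0 htop, fun b => ?_⟩
      rw [PMF.normalize_apply, hmarg, mul_left_comm, ENNReal.mul_inv_cancel h0 htop, mul_one]
  choose κ hκ using hex
  refine ⟨κ, ?_⟩
  ext ⟨a, b⟩
  rw [PMF.bind_apply, tsum_eq_single a]
  · have : (κ a).map (fun b => (a, b)) (a, b) = κ a b := by
      rw [PMF.map_apply, tsum_eq_single b]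
      · rw [if_pos rfl]
      · intro b' hb'
        exact if_neg fun h => hb' (Prod.ext_iff.mp h).2.symm
    rw [this, hκ]
  · intro a' ha'
    have : (κ a').map (fun b => (a', b)) (a, b) = 0 := by
      rw [PMF.map_apply]
      refine ENNReal.tsum_eq_zero.mpr fun b' => if_neg fun h => ha' (Prod.ext_iff.mp h).1.symm
    rw [this, mul_zero]

theorem le_length_of_countLaw_apply_ne_zero (l : List (PMF Bool)) :
    ∀ c, countLaw l c ≠ 0 → c ≤ l.length := by
  induction l with
  | nil =>
    intro c hc
    by_contra h
    exact hc (PMF.pure_apply_of_ne _ _ (by simpa using h))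
  | cons p l ih =>
    intro c hc
    rw [countLaw, ← PMF.mem_support_iff] at hc
    obtain ⟨b, _, hb⟩ := (PMF.mem_support_bind_iff _ _ _).mp hc
    obtain ⟨d, hd, rfl⟩ := (PMF.mem_support_map_iff _ _ _).mp hb
    have := ih d ((PMF.mem_support_iff _ _).mp hd)
    have := Bool.toNat_le b
    rw [List.length_cons]
    omega

/-- The number of `true` reports of one user with input `b` and of the users of a fixed list is a
post-processing of `clonePair`, by a kernel that does not depend on `b`. -/
theorem exists_countLaw_eq_clonePair_bind (εL : ℝ) (hL : 0 ≤ εL) (xs : List Bool) :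
    ∃ K : ℕ × ℕ → PMF ℕ, ∀ b,
      countLaw (warnerRR εL b :: xs.map (warnerRR εL)) =
        (clonePair (xs.length + 1) εL hL b).bind K := by
  obtain ⟨L, hLx⟩ := exists_warnerRR_eq_bind εL hL
  set f := coin (Real.exp (-εL)) (Real.exp_pos _).le
    (Real.exp_le_one_iff.mpr (neg_nonpos.mpr hL)) with hf
  obtain ⟨κ, hκ⟩ := exists_disintegration (cloneLaw f L xs)
  rw [cloneLaw_map_fst] at hκ
  -- The two coordinates of `clonePair` add up to the number of clones plus one.
  refine ⟨fun d => (κ (d.1 + d.2 - 1)).map fun z => d.1 + z, fun b => ?_⟩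
  rw [countLaw, countLaw_eq_cloneLaw_bind f L _ hLx, hκ, clonePair, binom_eq_countLaw,
    Nat.add_sub_cancel]
  simp only [PMF.bind_bind, PMF.map_bind, PMF.bind_map, PMF.map_comp, Function.comp_def,
    binom_eq_countLaw]
  rw [PMF.bind_comm]
  congr 1
  funext c
  have hrhs : ∀ a, countLaw (List.replicate c fairCoin) a ≠ 0 →
      ((warnerRR εL b).bind fun Δ => (κ ((if Δ = true then (a + 1, c - a)
        else (a, c - a + 1)).1 + (if Δ = true then (a + 1, c - a)
        else (a, c - a + 1)).2 - 1)).map fun z => (if Δ = true then (a + 1, c - a)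
        else (a, c - a + 1)).1 + z) =
      (warnerRR εL b).bind fun Δ => (κ c).map fun z => Δ.toNat + (a + z) := fun a ha => by
    have hac : a ≤ c := by
      simpa using le_length_of_countLaw_apply_ne_zero _ a ha
    congr 1
    funext Δ
    cases Δ
    · have : a + (c - a + 1) - 1 = c := by omega
      simp [this]
    · have : a + 1 + (c - a) - 1 = c := by omega
      simp only [if_true, this, Bool.toNat_true]
      congr 1
      funext z
      omega
  rw [bind_congr_of_apply_ne_zero _ hrhs]
  conv_rhs => rw [PMF.bind_comm]
  congr 1
  funext Δ
  simp only [PMF.map]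
  rw [PMF.bind_comm]
  rfl

theorem countLaw_fairCoin_symm (c : ℕ) :
    (countLaw (List.replicate c fairCoin)).map (fun a => c - a) =
      countLaw (List.replicate c fairCoin) := by
  have hfair : fairCoin = fairCoin.map not := by
    ext y
    rw [PMF.map_apply, tsum_bool]
    cases y <;> norm_num [coin_apply]
  have hflip : ∀ F : Bool → PMF ℕ, fairCoin.bind F = fairCoin.bind (F ∘ not) := fun F => by
    rw [← PMF.bind_map, ← hfair]
  induction c with
  | zero => exact PMF.pure_map _ _
  | succ c ih =>
    rw [List.replicate_succ, countLaw, PMF.map_bind]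
    conv_rhs => rw [hflip, ← ih]
    congr 1
    funext b
    rw [Function.comp, PMF.map_comp, PMF.map_comp]
    refine bind_congr_of_apply_ne_zero _ fun a ha => ?_
    have hac : a ≤ c := by
      simpa using le_length_of_countLaw_apply_ne_zero _ a ha
    simp only [Function.comp]
    congr 1
    cases b <;> simp <;> omega

/-- `clonePair` with the opposite bit is the mirror image, because `Bin(C, 1/2)` is symmetric. -/
theorem clonePair_map_swap (m : ℕ) (εL : ℝ) (hL : 0 ≤ εL) (b : Bool) :
    (clonePair m εL hL b).map Prod.swap = clonePair m εL hL (!b) := by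
  unfold clonePair
  rw [PMF.map_bind]
  congr 1
  funext C
  rw [PMF.map_bind, binom_eq_countLaw]
  conv_rhs => rw [← countLaw_fairCoin_symm, PMF.bind_map]
  refine bind_congr_of_apply_ne_zero _ fun a ha => ?_
  have hac : a ≤ C := by
    simpa using le_length_of_countLaw_apply_ne_zero _ a ha
  rw [Function.comp, warnerRR_not, PMF.map_comp, PMF.map_comp]
  congr 1
  funext Δ
  cases Δ <;> simp [Function.comp, Nat.sub_sub_self hac]

theorem indist_clonePair {m : ℕ} {ε δ εL : ℝ} (hL : 0 ≤ εL)
    (h : Indist ε δ (clonePair m εL hL true) (clonePair m εL hL false)) (b : Bool) :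
    Indist ε δ (clonePair m εL hL b) (clonePair m εL hL (!b)) := by
  cases b
  · have := h.map Prod.swap
    rwa [clonePair_map_swap, clonePair_map_swap] at this
  · exact h

/-! ### The shuffler -/

/-- A uniformly shuffled vector of bits depends on the vector through the number of `true`s. -/
theorem exists_shuffle_eq (ι : Type) [Fintype ι] [DecidableEq ι] :
    ∃ K : ℕ → PMF (ι → Bool), ∀ y : ι → Bool,
      ((PMF.uniformOfFintype (Equiv.Perm ι)).map fun π => fun k => y (π k)) =
        K (Finset.univ.filter fun i => y i = true).card := by
  have key : ∀ y y' : ι → Bool, (Finset.univ.filter fun i => y i = true).card =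
      (Finset.univ.filter fun i => y' i = true).card →
      ((PMF.uniformOfFintype (Equiv.Perm ι)).map fun π => fun k => y (π k)) =
      (PMF.uniformOfFintype (Equiv.Perm ι)).map fun π => fun k => y' (π k) := by
    intro y y' h
    obtain ⟨e⟩ : Nonempty ({i // y i = true} ≃ {i // y' i = true}) := by
      rw [← Fintype.card_eq, Fintype.card_subtype, Fintype.card_subtype, h]
    have hτ : ∀ i, y' (e.extendSubtype i) = y i := fun i => by
      by_cases hi : y i = true
      · rw [hi, e.extendSubtype_mem i hi]
      · rw [Bool.eq_false_iff.mpr hi]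
        exact Bool.eq_false_iff.mpr (e.extendSubtype_not_mem i hi)
    have hunif : (PMF.uniformOfFintype (Equiv.Perm ι)).map (fun π => e.extendSubtype * π) =
        PMF.uniformOfFintype (Equiv.Perm ι) := by
      ext π
      rw [PMF.map_apply, tsum_eq_single (e.extendSubtype⁻¹ * π)]
      · simp
      · intro π' hπ'
        refine if_neg fun h => hπ' ?_
        rw [h]; group
    conv_rhs => rw [← hunif, PMF.map_comp]
    congr 1
    funext π k
    exact (hτ (π k)).symm
  classical
  refine ⟨fun c => if h : ∃ y : ι → Bool, (Finset.univ.filter fun i => y i = true).card = c then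
    (PMF.uniformOfFintype (Equiv.Perm ι)).map fun π => fun k => h.choose (π k)
    else PMF.pure fun _ => false, fun y => ?_⟩
  have hex : ∃ y' : ι → Bool, (Finset.univ.filter fun i => y' i = true).card =
    (Finset.univ.filter fun i => y i = true).card := ⟨y, rfl⟩
  beta_reduce
  rw [dif_pos hex]
  exact key _ _ hex.choose_spec.symm

/-- Shuffling randomized responses hides the input of one user, whatever the other inputs are. -/
theorem indist_shuffle {ι : Type} [Fintype ι] [DecidableEq ι] {ε δ εL : ℝ} (hε : 0 ≤ ε)
    (h : IsNumericalBound (Fintype.card ι) ε δ εL) {x x' : ι → Bool} (k₀ : ι)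
    (hx : ∀ k, k ≠ k₀ → x k = x' k) :
    Indist ε δ
      ((indep fun k => warnerRR εL (x k)).bind fun y =>
        (PMF.uniformOfFintype (Equiv.Perm ι)).map fun π => fun k => y (π k))
      ((indep fun k => warnerRR εL (x' k)).bind fun y =>
        (PMF.uniformOfFintype (Equiv.Perm ι)).map fun π => fun k => y (π k)) := by
  obtain ⟨hL, h⟩ := h
  by_cases hk₀ : x k₀ = x' k₀
  · have : x = x' := funext fun k => by
      by_cases hk : k = k₀
      · rw [hk, hk₀]
      · exact hx k hk
    rw [this]
    exact Indist.refl hε _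
  obtain ⟨K, hK⟩ := exists_shuffle_eq ι
  let l := (Finset.univ.erase k₀).toList
  have hl : (k₀ :: l).Nodup := by
    rw [List.nodup_cons]
    exact ⟨by simp [l], Finset.nodup_toList _⟩
  have hlen : l.length + 1 = Fintype.card ι := by
    rw [Finset.length_toList, Finset.card_erase_of_mem (Finset.mem_univ _), Finset.card_univ]
    have := Fintype.card_pos_iff.mpr ⟨k₀⟩
    omega
  have hcard : ∀ y : ι → Bool, (Finset.univ.filter fun i => y i = true).card =
      ((k₀ :: l).map fun k => (y k).toNat).sum := fun y => by
    rw [card_filter_eq_sum_toNat, Finset.sum_map_toList, List.map_cons, List.sum_cons,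
      Finset.sum_map_toList, Finset.add_sum_erase _ (fun k => (y k).toNat) (Finset.mem_univ _)]
  have hlaw : ∀ z : ι → Bool, ((indep fun k => warnerRR εL (z k)).bind fun y =>
      (PMF.uniformOfFintype (Equiv.Perm ι)).map fun π => fun k => y (π k)) =
      (countLaw (warnerRR εL (z k₀) :: (l.map z).map (warnerRR εL))).bind K := fun z => by
    simp_rw [hK, hcard]
    have := indep_map_sum_eq_countLaw (fun k => warnerRR εL (z k)) _ hl
    rw [List.map_cons] at this
    rw [List.map_map, Function.comp_def, ← this, PMF.bind_map]
    rfl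
  have hmap : l.map x = l.map x' := List.map_congr_left fun k hk =>
    hx k (Finset.ne_of_mem_erase (Finset.mem_toList.mp hk))
  obtain ⟨K', hK'⟩ := exists_countLaw_eq_clonePair_bind εL hL (l.map x')
  have hnot : x' k₀ = !x k₀ := by
    cases h1 : x k₀ <;> cases h2 : x' k₀ <;> simp_all
  rw [hlaw, hlaw, hmap, hK', hK', List.length_map, hlen, hnot]
  exact ((indist_clonePair hL h (x k₀)).bind K').bind K

/-! ### Binomial tails -/

theorem tsum_bind_mul {α β : Type} (p : PMF α) (f : α → PMF β) (g : β → ℝ≥0∞) :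
    ∑' b, p.bind f b * g b = ∑' a, p a * ∑' b, f a b * g b := by
  simp_rw [PMF.bind_apply, ← ENNReal.tsum_mul_right, ← ENNReal.tsum_mul_left, mul_assoc]
  exact ENNReal.tsum_comm

theorem tsum_map_mul {α β : Type} (p : PMF α) (f : α → β) (g : β → ℝ≥0∞) :
    ∑' b, p.map f b * g b = ∑' a, p a * g (f a) := by
  rw [PMF.map, tsum_bind_mul]
  refine tsum_congr fun a => ?_
  rw [tsum_eq_single (f a) fun b hb => by
    rw [Function.comp, PMF.pure_apply_of_ne _ _ hb, zero_mul], Function.comp, PMF.pure_apply_self,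
    one_mul]

/-- The probability generating function of the binomial distribution. -/
theorem tsum_binom_mul_pow (N : ℕ) (p : ℝ) (h0 : 0 ≤ p) (h1 : p ≤ 1) (z : ℝ) (hz : 0 ≤ z) :
    ∑' c, binom N p h0 h1 c * ENNReal.ofReal z ^ c = ENNReal.ofReal ((1 - p + p * z) ^ N) := by
  have h1' : 0 ≤ 1 - p := by linarith
  induction N with
  | zero =>
    rw [binom_zero, tsum_eq_single 0 fun c hc => by
      rw [PMF.pure_apply_of_ne _ _ hc, zero_mul], PMF.pure_apply_self]
    simp
  | succ N ih =>
    rw [binom_succ, tsum_bind_mul, tsum_bool]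
    simp_rw [tsum_map_mul, pow_add, mul_left_comm (binom N p h0 h1 _), ENNReal.tsum_mul_left, ih,
      coin_apply]
    simp only [Bool.false_eq_true, if_true, if_false, Bool.toNat_false, Bool.toNat_true, pow_zero,
      pow_one, one_mul]
    rw [← ENNReal.ofReal_mul hz, ← ENNReal.ofReal_mul h1', ← ENNReal.ofReal_mul h0,
      ← ENNReal.ofReal_add (by positivity) (by positivity)]
    congr 1
    ring

/-- Chernoff's method for the binomial distribution. -/
theorem binom_toOuterMeasure_le (N : ℕ) (p : ℝ) (h0 : 0 ≤ p) (h1 : p ≤ 1) (S : Set ℕ) {w z : ℝ}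
    (hw : 0 ≤ w) (hz : 0 ≤ z) (hS : ∀ c ∈ S, 1 ≤ w * z ^ c) :
    (binom N p h0 h1).toOuterMeasure S ≤ ENNReal.ofReal (w * (1 - p + p * z) ^ N) := by
  rw [ENNReal.ofReal_mul hw, ← tsum_binom_mul_pow N p h0 h1 z hz, PMF.toOuterMeasure_apply,
    ← ENNReal.tsum_mul_left]
  refine ENNReal.tsum_le_tsum fun c => ?_
  by_cases hc : c ∈ S
  · rw [Set.indicator_of_mem hc, mul_left_comm]
    refine le_mul_of_one_le_right' ?_
    rw [← ENNReal.ofReal_pow hz, ← ENNReal.ofReal_mul hw, ← ENNReal.ofReal_one]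
    exact ENNReal.ofReal_le_ofReal (hS c hc)
  · rw [Set.indicator_of_notMem hc]
    exact zero_le

theorem binom_lower_tail (N : ℕ) (p : ℝ) (h0 : 0 ≤ p) (h1 : p ≤ 1) (a : ℝ) :
    (binom N p h0 h1).toOuterMeasure {c | (c : ℝ) < a} ≤
      ENNReal.ofReal (Real.exp (a * Real.log 2 - p * N / 2)) := by
  refine (binom_toOuterMeasure_le N p h0 h1 _ (w := Real.exp (a * Real.log 2)) (z := 1 / 2)
    (Real.exp_pos _).le (by norm_num) fun c hc => ?_).trans (ENNReal.ofReal_le_ofReal ?_)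
  · have hhalf : (1 / 2 : ℝ) = Real.exp (-Real.log 2) := by
      rw [Real.exp_neg, Real.exp_log two_pos, one_div]
    rw [hhalf, ← Real.exp_nat_mul, ← Real.exp_add]
    have hc' : (c : ℝ) < a := hc
    have := Real.log_pos one_lt_two
    exact Real.one_le_exp (by nlinarith)
  · rw [sub_eq_add_neg (a * Real.log 2), Real.exp_add]
    gcongr
    have h2 : 1 - p + p * (1 / 2) ≤ Real.exp (-(p / 2)) := by
      have := Real.add_one_le_exp (-(p / 2))
      linarith
    calc (1 - p + p * (1 / 2)) ^ N ≤ Real.exp (-(p / 2)) ^ N :=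
          pow_le_pow_left₀ (by linarith) h2 N
      _ = Real.exp (-(p * N / 2)) := by
          rw [← Real.exp_nat_mul]
          congr 1
          ring

/-- Hoeffding's inequality for fair coins. -/
theorem binom_half_upper_tail (c : ℕ) (hc : 0 < c) (u : ℝ) (hu : 0 ≤ u) :
    (binom c (1 / 2) (by norm_num) (by norm_num)).toOuterMeasure {a | (c : ℝ) / 2 + u ≤ a} ≤
      ENNReal.ofReal (Real.exp (-(2 * u ^ 2 / c))) := by
  have hc' : (0 : ℝ) < c := Nat.cast_pos.mpr hc
  set s : ℝ := 4 * u / c with hs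
  have hs0 : 0 ≤ s := by positivity
  refine (binom_toOuterMeasure_le c _ _ _ _ (w := Real.exp (-s * (c / 2 + u))) (z := Real.exp s)
    (Real.exp_pos _).le (Real.exp_pos _).le fun a ha => ?_).trans (ENNReal.ofReal_le_ofReal ?_)
  · rw [← Real.exp_nat_mul, ← Real.exp_add]
    have ha' : (c : ℝ) / 2 + u ≤ a := ha
    exact Real.one_le_exp (by nlinarith)
  · have hcosh : 1 - 1 / 2 + 1 / 2 * Real.exp s = Real.exp (s / 2) * Real.cosh (s / 2) := by
      rw [Real.cosh_eq, mul_div_assoc', mul_add, ← Real.exp_add, ← Real.exp_add]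
      norm_num
      ring
    calc Real.exp (-s * (c / 2 + u)) * (1 - 1 / 2 + 1 / 2 * Real.exp s) ^ c
        ≤ Real.exp (-s * (c / 2 + u)) *
            (Real.exp (s / 2) * Real.exp ((s / 2) ^ 2 / 2)) ^ c := by
          rw [hcosh]
          have := Real.cosh_le_exp_half_sq (s / 2)
          have := (Real.cosh_pos (s / 2)).le
          gcongr
      _ = Real.exp (-(2 * u ^ 2 / c)) := by
          rw [← Real.exp_add, ← Real.exp_nat_mul, ← Real.exp_add, hs]
          congr 1
          field_simp
          ring

/-! ### The closed-form bound -/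

theorem binom_half_apply (c a : ℕ) : binom c (1 / 2) (by norm_num) (by norm_num) a =
    ENNReal.ofReal ((c.choose a : ℝ) / 2 ^ c) := by
  induction c generalizing a with
  | zero =>
    rw [binom_zero]
    cases a with
    | zero => simp
    | succ a => rw [PMF.pure_apply_of_ne _ _ (Nat.succ_ne_zero a)]; simp
  | succ c ih =>
    have hzero : ∀ q : PMF ℕ, (q.map fun d => 0 + d) = q := fun q => by
      simp_rw [zero_add]; exact PMF.map_id q
    have hsucc : ∀ (q : PMF ℕ) (d : ℕ), (q.map fun d => 1 + d) (d + 1) = q d := fun q d => by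
      rw [PMF.map_apply, tsum_eq_single d]
      · exact if_pos (by omega)
      · exact fun b hb => if_neg (by omega)
    have hsucc0 : ∀ q : PMF ℕ, (q.map fun d => 1 + d) 0 = 0 := fun q => by
      rw [PMF.map_apply]
      exact ENNReal.tsum_eq_zero.mpr fun b => if_neg (by omega)
    rw [binom_succ, PMF.bind_apply, tsum_bool]
    simp only [Bool.toNat_false, Bool.toNat_true, hzero, coin_apply, Bool.false_eq_true, if_true,
      if_false]
    cases a with
    | zero =>
      rw [hsucc0, mul_zero, add_zero, ih, ← ENNReal.ofReal_mul (by norm_num)]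
      congr 1
      simp only [Nat.choose_zero_right, pow_succ]
      push_cast
      field_simp
      norm_num
    | succ a =>
      rw [hsucc, ih, ih, ← ENNReal.ofReal_mul (by norm_num), ← ENNReal.ofReal_mul (by norm_num),
        ← ENNReal.ofReal_add (by positivity) (by positivity), Nat.choose_succ_succ]
      congr 1
      push_cast
      rw [pow_succ]
      field_simp
      ring

/-- The law of the clone counts, given that there are `c` clones and that the distinguished user
counts as an additional `true` (if `b`) or an additional `false` (if not `b`). -/
def cloneCounts (c : ℕ) (b : Bool) : PMF (ℕ × ℕ) :=
  (binom c (1 / 2) (by norm_num) (by norm_num)).map fun a =>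
    if b then (a + 1, c - a) else (a, c - a + 1)

/-- The likelihood ratio of the two laws of clone counts at `(a + 1, c - a)` is
`(a + 1) / (c - a)`. -/
theorem cloneCounts_toOuterMeasure_le (c : ℕ) (γ : ℝ) (hγ : 0 ≤ γ) (S : Set (ℕ × ℕ)) :
    (cloneCounts c true).toOuterMeasure S ≤
      ENNReal.ofReal (1 + γ) * (cloneCounts c false).toOuterMeasure S +
        (binom c (1 / 2) (by norm_num) (by norm_num)).toOuterMeasure
          {a | (1 + γ) * ((c : ℝ) - a) < a + 1} := by
  unfold cloneCounts
  set B := binom c (1 / 2) (by norm_num) (by norm_num) with hB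
  simp only [PMF.toOuterMeasure_map_apply, if_true, Bool.false_eq_true, if_false]
  simp only [PMF.toOuterMeasure_apply]
  set F : ℕ → ℝ≥0∞ := ((fun a => (a, c - a + 1)) ⁻¹' S).indicator B with hF
  calc ∑' a, ((fun a => (a + 1, c - a)) ⁻¹' S).indicator B a
      ≤ ∑' a, (ENNReal.ofReal (1 + γ) * F (a + 1) +
          {a : ℕ | (1 + γ) * ((c : ℝ) - a) < a + 1}.indicator B a) := by
        refine ENNReal.tsum_le_tsum fun a => ?_
        by_cases hbad : (1 + γ) * ((c : ℝ) - a) < a + 1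
        · rw [Set.indicator_of_mem (s := {a : ℕ | (1 + γ) * ((c : ℝ) - a) < a + 1}) hbad]
          exact (Set.indicator_le_self _ _ a).trans le_add_self
        refine le_trans ?_ le_self_add
        by_cases hS : (a + 1, c - a) ∈ S
        · rw [Set.indicator_of_mem (s := (fun a => (a + 1, c - a)) ⁻¹' S) hS]
          have hle := not_lt.mp hbad
          have hac : a < c := by
            by_contra h
            have : (c : ℝ) ≤ a := by exact_mod_cast not_lt.mp h
            nlinarith [(Nat.cast_nonneg a : (0 : ℝ) ≤ a)]
          have hmem : a + 1 ∈ (fun a => (a, c - a + 1)) ⁻¹' S := by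
            have : c - (a + 1) + 1 = c - a := by omega
            simpa [this] using hS
          rw [hF, Set.indicator_of_mem hmem, hB, binom_half_apply, binom_half_apply,
            ← ENNReal.ofReal_mul (by positivity)]
          refine ENNReal.ofReal_le_ofReal ?_
          have hch : (c.choose (a + 1) : ℝ) * (a + 1) = c.choose a * (c - a) := by
            have := Nat.choose_succ_right_eq c a
            rw [← Nat.cast_sub hac.le]
            exact_mod_cast this
          have hpos : (0 : ℝ) < c - a := sub_pos.mpr (by exact_mod_cast hac)
          rw [mul_div_assoc']
          gcongr
          refine le_of_mul_le_mul_right ?_ hpos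
          calc (c.choose a : ℝ) * (c - a) = c.choose (a + 1) * (a + 1) := hch.symm
            _ ≤ c.choose (a + 1) * ((1 + γ) * (c - a)) := by gcongr
            _ = _ := by ring
        · rw [Set.indicator_of_notMem (s := (fun a => (a + 1, c - a)) ⁻¹' S) hS]
          exact zero_le
    _ = ENNReal.ofReal (1 + γ) * ∑' a, F (a + 1) +
          ∑' a, {a : ℕ | (1 + γ) * ((c : ℝ) - a) < a + 1}.indicator B a := by
        rw [ENNReal.tsum_add, ENNReal.tsum_mul_left]
    _ ≤ _ := by
        exact add_le_add (mul_le_mul' le_rfl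
          (ENNReal.tsum_comp_le_tsum_of_injective (add_left_injective 1) F)) le_rfl

/-- The choice of constants in the closed-form bound: with `X = √M`, `y = √(2c)`, `b = √log(2/δ)`
and `d = √log(4/δ)`, the deviation of the clone counts that makes the likelihood ratio exceed
`1 + γ` is at least `b * y / 2`. -/
theorem deviation_bound {X y b d γ : ℝ} (hX : 0 < X) (hb : 0 ≤ b) (hbX : 4 * b ≤ X) (hbd : b ≤ d)
    (hXy : X ≤ y) (hγ : γ = 8 * d / X + 8 / X ^ 2) :
    b * y * (2 + γ) ≤ γ * y ^ 2 / 2 - 2 := by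
  have hd : 0 ≤ d := hb.trans hbd
  have hγ0 : 0 ≤ γ := by rw [hγ]; positivity
  have hγX : γ * X = 8 * d + 8 / X := by rw [hγ]; field_simp
  have hstart : 2 ≤ X * (γ * X / 2 - b * (2 + γ)) := by
    have h1 : X * (γ * X / 2 - b * (2 + γ)) - 2 =
        2 * (X * (d - b)) + 2 * (d * (X - 4 * b)) + 2 * ((X - 4 * b) / X) := by
      rw [hγ]; field_simp; ring
    have h2 : 0 ≤ X * (d - b) := mul_nonneg hX.le (by linarith)
    have h3 : 0 ≤ d * (X - 4 * b) := mul_nonneg hd (by linarith)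
    have h4 : 0 ≤ (X - 4 * b) / X := div_nonneg (by linarith) hX.le
    linarith
  have hB : 0 ≤ γ * X / 2 - b * (2 + γ) := by
    by_contra h
    nlinarith
  have hmono : X * (γ * X / 2 - b * (2 + γ)) ≤ y * (γ * y / 2 - b * (2 + γ)) :=
    mul_le_mul hXy (by nlinarith) hB (hX.le.trans hXy)
  nlinarith

/-- If `c` is at least half of `M`, the likelihood ratio of the clone counts exceeds `1 + γ` with
probability at most `δ / 2`. -/
theorem cloneCounts_tail {M δ γ : ℝ} (hδ : 0 < δ) (hδ1 : δ ≤ 1)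
    (hM : 16 * Real.log (2 / δ) ≤ M)
    (hγ : γ = 8 * √(Real.log (4 / δ)) / √M + 8 / M) (c : ℕ) (hc : M / 2 ≤ c) :
    (binom c (1 / 2) (by norm_num) (by norm_num)).toOuterMeasure
      {a | (1 + γ) * ((c : ℝ) - a) < a + 1} ≤ ENNReal.ofReal (δ / 2) := by
  have hℓ : 0 < Real.log (2 / δ) := Real.log_pos (by rw [lt_div_iff₀ hδ]; linarith)
  have hM0 : 0 < M := by linarith
  have hc0 : (0 : ℝ) < c := by linarith
  have hb2 := Real.sq_sqrt hℓ.le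
  have hX2 := Real.sq_sqrt hM0.le
  have hy2 := Real.sq_sqrt (by positivity : (0 : ℝ) ≤ 2 * c)
  have hγ0 : 0 ≤ γ := by rw [hγ]; positivity
  have hdev := deviation_bound (X := √M) (y := √(2 * c)) (b := √(Real.log (2 / δ)))
    (d := √(Real.log (4 / δ))) (γ := γ) (Real.sqrt_pos.mpr hM0) (Real.sqrt_nonneg _)
    (by
      refine Real.le_sqrt_of_sq_le ?_
      rw [mul_pow, hb2]; linarith)
    (Real.sqrt_le_sqrt (Real.log_le_log (by positivity) (by gcongr; norm_num)))
    (Real.sqrt_le_sqrt (by linarith)) (by rw [hX2]; exact hγ)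
  set b := √(Real.log (2 / δ))
  set y := √(2 * (c : ℝ))
  have hsub : {a : ℕ | (1 + γ) * ((c : ℝ) - a) < a + 1} ⊆
      {a : ℕ | (c : ℝ) / 2 + b * y / 2 ≤ a} := by
    intro a ha
    have ha' : (1 + γ) * ((c : ℝ) - a) < a + 1 := ha
    change (c : ℝ) / 2 + b * y / 2 ≤ a
    rw [hy2] at hdev
    nlinarith
  refine ((binom c _ _ _).toOuterMeasure.mono hsub).trans
    ((binom_half_upper_tail c (by exact_mod_cast hc0) _ (by positivity)).trans
      (ENNReal.ofReal_le_ofReal (le_of_eq ?_)))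
  have hexp : 2 * (b * y / 2) ^ 2 / c = Real.log (2 / δ) := by
    rw [div_pow, mul_pow, hb2, hy2]
    field_simp
  rw [hexp, ← Real.log_inv, Real.exp_log (by positivity), inv_div]

/-- The number of clones is at least half of `M = m e^{-ε_L}`, except with probability `δ / 2`. -/
theorem clones_tail {m : ℕ} (hm : 1 ≤ m) {p δ : ℝ} (h0 : 0 ≤ p) (h1 : p ≤ 1) (hδ : 0 < δ)
    (hδ1 : δ ≤ 1) (hM : 16 * Real.log (2 / δ) ≤ m * p) :
    (binom (m - 1) p h0 h1).toOuterMeasure {c | (c : ℝ) < m * p / 2} ≤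
      ENNReal.ofReal (δ / 2) := by
  refine (binom_lower_tail _ p h0 h1 _).trans (ENNReal.ofReal_le_ofReal ?_)
  have hℓ : Real.log 2 ≤ Real.log (2 / δ) :=
    Real.log_le_log two_pos (by rw [le_div_iff₀ hδ]; linarith)
  have h2 := Real.log_two_lt_d9
  have h2' := Real.log_two_gt_d9
  have hδ2 : δ / 2 = Real.exp (-Real.log (2 / δ)) := by
    rw [← Real.log_inv, Real.exp_log (by positivity), inv_div]
  rw [hδ2, Nat.cast_sub hm, Nat.cast_one]
  refine Real.exp_le_exp.mpr ?_
  nlinarith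

/-- The law of the clone counts for a random number of clones. -/
def mixedCloneCounts (N : ℕ) (p : ℝ) (h0 : 0 ≤ p) (h1 : p ≤ 1) (b : Bool) : PMF (ℕ × ℕ) :=
  (binom N p h0 h1).bind fun c => cloneCounts c b

theorem mixedCloneCounts_toOuterMeasure_le {m : ℕ} (hm : 1 ≤ m) {p δ γ : ℝ} (h0 : 0 ≤ p)
    (h1 : p ≤ 1) (hδ : 0 < δ) (hδ1 : δ ≤ 1) (hM : 16 * Real.log (2 / δ) ≤ m * p)
    (hγ : γ = 8 * √(Real.log (4 / δ)) / √(m * p) + 8 / (m * p)) (S : Set (ℕ × ℕ)) :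
    (mixedCloneCounts (m - 1) p h0 h1 true).toOuterMeasure S ≤
      ENNReal.ofReal (1 + γ) * (mixedCloneCounts (m - 1) p h0 h1 false).toOuterMeasure S +
        ENNReal.ofReal δ := by
  have hγ0 : 0 ≤ γ := by rw [hγ]; positivity
  unfold mixedCloneCounts
  rw [PMF.toOuterMeasure_bind_apply, PMF.toOuterMeasure_bind_apply]
  set N := binom (m - 1) p h0 h1 with hN
  set few : Set ℕ := {c | (c : ℝ) < m * p / 2} with hfew
  calc ∑' c, N c * (cloneCounts c true).toOuterMeasure S
      ≤ ∑' c, (ENNReal.ofReal (1 + γ) * (N c * (cloneCounts c false).toOuterMeasure S) +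
          (N c * ENNReal.ofReal (δ / 2) + few.indicator N c)) := by
        refine ENNReal.tsum_le_tsum fun c => ?_
        by_cases hc : c ∈ few
        · rw [Set.indicator_of_mem hc]
          calc N c * (cloneCounts c true).toOuterMeasure S ≤ N c * 1 := by
                gcongr; exact toOuterMeasure_le_one _ _
            _ = N c := mul_one _
            _ ≤ _ := le_add_self.trans le_add_self
        · rw [Set.indicator_of_notMem hc, add_zero, mul_left_comm, ← mul_add]
          gcongr
          refine (cloneCounts_toOuterMeasure_le c γ hγ0 S).trans ?_
          gcongr
          exact cloneCounts_tail hδ hδ1 hM hγ c (not_lt.mp hc)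
    _ = ENNReal.ofReal (1 + γ) * ∑' c, N c * (cloneCounts c false).toOuterMeasure S +
          (ENNReal.ofReal (δ / 2) + N.toOuterMeasure few) := by
        rw [ENNReal.tsum_add, ENNReal.tsum_add, ENNReal.tsum_mul_left, ENNReal.tsum_mul_right,
          N.tsum_coe, one_mul, PMF.toOuterMeasure_apply]
    _ ≤ ENNReal.ofReal (1 + γ) * ∑' c, N c * (cloneCounts c false).toOuterMeasure S +
          (ENNReal.ofReal (δ / 2) + ENNReal.ofReal (δ / 2)) := by
        gcongr
        exact clones_tail hm h0 h1 hδ hδ1 hM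
    _ = _ := by
        rw [← ENNReal.ofReal_add (by positivity) (by positivity), add_halves]

theorem clonePair_eq_bind (m : ℕ) (εL : ℝ) (hL : 0 ≤ εL) (b : Bool) :
    clonePair m εL hL b = (warnerRR εL b).bind fun Δ =>
      mixedCloneCounts (m - 1) (Real.exp (-εL)) (Real.exp_pos _).le
        (Real.exp_le_one_iff.mpr (neg_nonpos.mpr hL)) Δ := by
  unfold clonePair mixedCloneCounts
  rw [PMF.bind_comm]
  congr 1
  funext C
  unfold cloneCounts
  simp only [PMF.map]
  rw [PMF.bind_comm]
  rfl

/-- Mixing two laws with weights `e / (e + 1)` and `1 / (e + 1)`, in both orders, contracts the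
excess `γ` of the likelihood ratio by the factor `(e - 1) / (e + 1)`. -/
theorem mixture_contraction {e γ δ x y : ℝ} (he : 1 ≤ e) (hγ : 0 ≤ γ) (hδ : 0 ≤ δ) (hx : 0 ≤ x)
    (hy : 0 ≤ y) (h : x ≤ (1 + γ) * y + δ) :
    e / (e + 1) * x + 1 / (e + 1) * y ≤
      (1 + (e - 1) / (e + 1) * γ) * (1 / (e + 1) * x + e / (e + 1) * y) + δ := by
  have he1 : 0 < e + 1 := by linarith
  set r := 1 / (e + 1) with hr
  have hr0 : 0 < r := by positivity
  have hre : e / (e + 1) = 1 - r := by rw [hr]; field_simp; ring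
  have hβ : (e - 1) / (e + 1) = 1 - 2 * r := by rw [hr]; field_simp; ring
  have hr1 : 2 * r ≤ 1 := by rw [hr, mul_one_div, div_le_one he1]; linarith
  rw [hre, hβ]
  have hβ0 : 0 ≤ 1 - 2 * r := by linarith
  suffices (1 - 2 * r) * (x - y) ≤ (1 - 2 * r) * γ * (r * x + (1 - r) * y) + δ by linarith
  have hQ : 0 ≤ r * x + (1 - r) * y := by
    have : 0 ≤ 1 - r := by linarith
    positivity
  rcases le_total x y with hxy | hxy
  · have h1 : (1 - 2 * r) * (x - y) ≤ 0 := mul_nonpos_of_nonneg_of_nonpos hβ0 (by linarith)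
    have h2 : 0 ≤ (1 - 2 * r) * γ * (r * x + (1 - r) * y) := by positivity
    linarith
  · calc (1 - 2 * r) * (x - y) ≤ (1 - 2 * r) * (γ * y + δ) := by gcongr; linarith
      _ = (1 - 2 * r) * γ * y + (1 - 2 * r) * δ := by ring
      _ ≤ (1 - 2 * r) * γ * (r * x + (1 - r) * y) + 1 * δ := by
          gcongr
          · nlinarith
          · linarith
      _ = _ := by rw [one_mul]

/-- The closed-form bound is an upper bound for the numerical one. -/
theorem IsClosedFormBound.isNumericalBound {m : ℕ} (hm : 1 ≤ m) {ε δ εL : ℝ} (hδ1 : δ ≤ 1)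
    (hL : 0 ≤ εL) (h : IsClosedFormBound m ε δ εL) : IsNumericalBound m ε δ εL := by
  obtain ⟨hδ, hrange, hε⟩ := h
  refine ⟨hL, fun S => ?_⟩
  set e := Real.exp εL with he
  have he1 : 1 ≤ e := Real.one_le_exp hL
  have he0 : 0 < e := Real.exp_pos _
  have hm0 : (0 : ℝ) < m := by exact_mod_cast hm
  have hℓ : 0 < Real.log (2 / δ) := Real.log_pos (by rw [lt_div_iff₀ hδ]; linarith)
  have hp : Real.exp (-εL) = e⁻¹ := Real.exp_neg _
  have hM : 16 * Real.log (2 / δ) ≤ m * Real.exp (-εL) := by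
    have h1 : e ≤ m / (16 * Real.log (2 / δ)) := by
      rw [← Real.exp_log (by positivity : (0 : ℝ) < m / (16 * Real.log (2 / δ))), he]
      exact Real.exp_le_exp.mpr hrange
    rw [le_div_iff₀ (by positivity)] at h1
    rw [hp, ← div_eq_mul_inv, le_div_iff₀ he0, mul_comm]
    exact h1
  set γ := 8 * √(e * Real.log (4 / δ)) / √(m : ℝ) + 8 * e / (m : ℝ) with hγdef
  have hγ : γ = 8 * √(Real.log (4 / δ)) / √(m * Real.exp (-εL)) + 8 / (m * Real.exp (-εL)) := by
    have hse : 0 < √e := Real.sqrt_pos.mpr he0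
    have hsm : 0 < √(m : ℝ) := Real.sqrt_pos.mpr hm0
    rw [hγdef, hp, Real.sqrt_mul he0.le, Real.sqrt_mul hm0.le, Real.sqrt_inv]
    field_simp
  have hγ0 : 0 ≤ γ := by rw [hγdef]; positivity
  have hβ0 : 0 ≤ (e - 1) / (e + 1) := div_nonneg (by linarith) (by linarith)
  have hexp : Real.exp ε = 1 + (e - 1) / (e + 1) * γ := by
    rw [hε]
    exact Real.exp_log (by positivity)
  have hmix := mixedCloneCounts_toOuterMeasure_le hm (Real.exp_pos (-εL)).le
    (Real.exp_le_one_iff.mpr (neg_nonpos.mpr hL)) hδ hδ1 hM hγ S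
  rw [clonePair_eq_bind, clonePair_eq_bind, PMF.toOuterMeasure_bind_apply,
    PMF.toOuterMeasure_bind_apply, tsum_bool, tsum_bool]
  set T := mixedCloneCounts (m - 1) (Real.exp (-εL)) (Real.exp_pos _).le
    (Real.exp_le_one_iff.mpr (neg_nonpos.mpr hL))
  have hT : ∀ b, (T b).toOuterMeasure S = ENNReal.ofReal ((T b).toOuterMeasure S).toReal :=
    fun b => (ENNReal.ofReal_toReal
      (ne_top_of_le_ne_top ENNReal.one_ne_top (toOuterMeasure_le_one _ _))).symm
  have hx0 : 0 ≤ ((T true).toOuterMeasure S).toReal := ENNReal.toReal_nonneg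
  have hy0 : 0 ≤ ((T false).toOuterMeasure S).toReal := ENNReal.toReal_nonneg
  rw [hT true, hT false] at hmix ⊢
  generalize ((T true).toOuterMeasure S).toReal = x at *
  generalize ((T false).toOuterMeasure S).toReal = y at *
  rw [← ENNReal.ofReal_mul (by positivity), ← ENNReal.ofReal_add (by positivity) hδ.le,
    ENNReal.ofReal_le_ofReal_iff (by positivity)] at hmix
  have hcontr := mixture_contraction he1 hγ0 hδ.le hx0 hy0 hmix
  simp only [warnerRR_apply, ← he, if_true, Bool.false_eq_true, Bool.true_eq_false, if_false]
  rw [← ENNReal.ofReal_mul (by positivity), ← ENNReal.ofReal_mul (by positivity),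
    ← ENNReal.ofReal_mul (by positivity), ← ENNReal.ofReal_mul (by positivity),
    ← ENNReal.ofReal_add (by positivity) (by positivity),
    ← ENNReal.ofReal_add (by positivity) (by positivity),
    ← ENNReal.ofReal_mul (by positivity), ← ENNReal.ofReal_add (by positivity) hδ.le, hexp]
  refine ENNReal.ofReal_le_ofReal ?_
  linarith

/-! ### The view of the data collector -/

theorem card_others {n : ℕ} {i j : Fin n} (hij : i ≠ j) : Fintype.card (Others i j) = n - 2 := by
  have h : (Finset.univ.filter fun k : Fin n => k ≠ i ∧ k ≠ j) = Finset.univ \ {i, j} := by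
    ext k; simp
  rw [Fintype.card_subtype, h, Finset.card_sdiff_of_subset (Finset.subset_univ _),
    Finset.card_univ, Fintype.card_fin, Finset.card_pair hij]

theorem WS_congr {n : ℕ} {A A' : Matrix (Fin n) (Fin n) Bool} {i j : Fin n} (εL : ℝ)
    (h : ∀ k, k ≠ i → k ≠ j → wedge A i j k = wedge A' i j k) : WS A εL i j = WS A' εL i j := by
  unfold WS
  congr 2
  funext k
  rw [h k k.2.1 k.2.2]

/-- One run of the wedge shuffler hides the wedge indicator of any one user `a`. -/
theorem indist_WS {n : ℕ} {ε δ εL : ℝ} (hε : 0 ≤ ε) (h : IsNumericalBound (n - 2) ε δ εL)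
    {A A' : Matrix (Fin n) (Fin n) Bool} {i j : Fin n} (hij : i ≠ j) (a : Fin n)
    (hA : ∀ k, k ≠ i → k ≠ j → k ≠ a → wedge A i j k = wedge A' i j k) :
    Indist ε δ (WS A εL i j) (WS A' εL i j) := by
  by_cases ha : a ≠ i ∧ a ≠ j
  · rw [← card_others hij] at h
    exact indist_shuffle (x := fun k : Others i j => wedge A i j k)
      (x' := fun k : Others i j => wedge A' i j k) hε h ⟨a, ha⟩ fun k hk =>
        hA k k.2.1 k.2.2 fun hka => hk (Subtype.ext hka)
  · rw [WS_congr εL fun k hki hkj => hA k hki hkj fun hka => ha (hka ▸ ⟨hki, hkj⟩)]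
    exact Indist.refl hε _

theorem fstPos_ne_sndPos {n t : ℕ} (ht : t ≤ n / 2) (s s' : Fin t) :
    fstPos ht s ≠ sndPos ht s' := fun h => by
  have := congrArg Fin.val h
  simp only [fstPos, sndPos] at this
  omega

/-- As the user-pairs are disjoint, a user belongs to at most one of them. -/
theorem exists_pair_of_user {n t : ℕ} (ht1 : 1 ≤ t) (ht : t ≤ n / 2) (σ : Equiv.Perm (Fin n))
    (b : Fin n) : ∃ s₀ : Fin t, ∀ s, s ≠ s₀ → σ (fstPos ht s) ≠ b ∧ σ (sndPos ht s) ≠ b := by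
  by_cases h : ∃ s₀ : Fin t, σ (fstPos ht s₀) = b ∨ σ (sndPos ht s₀) = b
  · obtain ⟨s₀, h₀⟩ := h
    refine ⟨s₀, fun s hs => ?_⟩
    have hval : (s : ℕ) ≠ s₀ := fun h => hs (Fin.ext h)
    have hpos : ∀ i, σ i = b → (i : ℕ) / 2 = s₀ := fun i hi => by
      rcases h₀ with h₀ | h₀
      · rw [σ.injective (hi.trans h₀.symm)]
        simp only [fstPos]; omega
      · rw [σ.injective (hi.trans h₀.symm)]
        simp only [sndPos]; omega
    constructor
    · intro hi
      have := hpos _ hi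
      simp only [fstPos] at this
      omega
    · intro hi
      have := hpos _ hi
      simp only [sndPos] at this
      omega
  · push Not at h
    exact ⟨⟨0, ht1⟩, fun s _ => h s⟩

/-- The entry `(a, b)` is used only by the pair that contains `b`, and there only by user `a`. -/
theorem elementDP_collectorView {n t : ℕ} (ht1 : 1 ≤ t) (ht : t ≤ n / 2) {ε δ εL : ℝ} (hε : 0 ≤ ε)
    (h : IsNumericalBound (n - 2) ε δ εL) : ElementDP (collectorView (t := t) ht εL) ε δ := by
  rintro A A' ⟨a, b, -, hAA'⟩
  refine Indist.mixture _ fun σ => Indist.map ?_ _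
  obtain ⟨s₀, hs₀⟩ := exists_pair_of_user ht1 ht σ b
  have hne : ∀ s, σ (fstPos ht s) ≠ σ (sndPos ht s) := fun s =>
    σ.injective.ne (fstPos_ne_sndPos ht s s)
  refine indist_indep_of_eq_off s₀ (fun s hs => WS_congr εL fun k _ _ => ?_)
    (indist_WS hε h (hne s₀) a fun k _ _ hk => ?_)
  · obtain ⟨h1, h2⟩ := hs₀ s hs
    simp only [wedge, hAA' _ _ (Or.inr h1), hAA' _ _ (Or.inr h2)]
  · simp only [wedge, hAA' _ _ (Or.inl hk)]

theorem DifferInOneEdge.exists_adjacency_eq {n : ℕ} {G G' : SimpleGraph (Fin n)}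
    (h : DifferInOneEdge G G') : ∃ a b : Fin n, ∀ c d, ¬(c = a ∧ d = b) → ¬(c = b ∧ d = a) →
      adjacency G c d = adjacency G' c d := by
  obtain ⟨e, he⟩ := h
  induction e with
  | h a b =>
    refine ⟨a, b, fun c d h1 h2 => ?_⟩
    have hnot : s(c, d) ∉ symmDiff G.edgeSet G'.edgeSet := by
      rw [he, Set.mem_singleton_iff, Sym2.eq_iff]
      tauto
    rw [Set.mem_symmDiff, SimpleGraph.mem_edgeSet, SimpleGraph.mem_edgeSet] at hnot
    unfold adjacency
    rw [decide_eq_decide]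
    tauto

/-- The edge `{a, b}` is used by the pair that contains `a`, only through user `b`, and by the pair
that contains `b`, only through user `a`. If the pair is `(a, b)` itself, it is not used. -/
theorem edgeDP_collectorView {n t : ℕ} (ht1 : 1 ≤ t) (ht : t ≤ n / 2) {ε δ εL : ℝ} (hε : 0 ≤ ε)
    (hδ : 0 ≤ δ) (h : IsNumericalBound (n - 2) ε δ εL) :
    EdgeDP (collectorView (t := t) ht εL) (2 * ε) (2 * δ) := by
  intro G G' hGG'
  obtain ⟨a, b, hAA'⟩ := hGG'.exists_adjacency_eq
  set A := adjacency G
  set A' := adjacency G'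
  refine Indist.mixture _ fun σ => Indist.map ?_ _
  obtain ⟨s₀, hs₀⟩ := exists_pair_of_user ht1 ht σ a
  obtain ⟨s₁, hs₁⟩ := exists_pair_of_user ht1 ht σ b
  have hWS : ∀ s, Indist ε δ (WS A εL (σ (fstPos ht s)) (σ (sndPos ht s)))
      (WS A' εL (σ (fstPos ht s)) (σ (sndPos ht s))) := fun s => by
    have hne : σ (fstPos ht s) ≠ σ (sndPos ht s) := σ.injective.ne (fstPos_ne_sndPos ht s s)
    generalize σ (fstPos ht s) = i at hne ⊢
    generalize σ (sndPos ht s) = j at hne ⊢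
    by_cases ha : i = a ∨ j = a
    · -- User `a` is one of the pair and reports nothing, so only user `b` may report differently.
      refine indist_WS hε h hne b fun k hki hkj hkb => ?_
      have hka : k ≠ a := by rintro rfl; rcases ha with rfl | rfl <;> contradiction
      simp only [wedge, hAA' k _ (fun h => hka h.1) (fun h => hkb h.1)]
    · push Not at ha
      refine indist_WS hε h hne a fun k hki hkj hka => ?_
      simp only [wedge, hAA' k i (fun h => hka h.1) (fun h => ha.1 h.2),
        hAA' k j (fun h => hka h.1) (fun h => ha.2 h.2)]
  refine indist_indep_of_eq_off_two hε hδ s₀ s₁ (fun s h₀ h₁ => WS_congr εL fun k _ _ => ?_)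
    (hWS s₀) (hWS s₁)
  obtain ⟨h1, h2⟩ := hs₀ s h₀
  obtain ⟨h3, h4⟩ := hs₁ s h₁
  simp only [wedge, hAA' k _ (fun h => h3 h.2) (fun h => h1 h.2),
    hAA' k _ (fun h => h4 h.2) (fun h => h2 h.2)]

end WedgeShuffle

end

theorem mainTheorem6 (n : ℕ) (hn : 3 ≤ n) (t : ℕ) (ht1 : 1 ≤ t) (ht : t ≤ n / 2)
    (ε δ : ℝ) (hε : 0 ≤ ε) (hδ0 : 0 ≤ δ) (hδ1 : δ ≤ 1)
    (εL : ℝ) (hεL : WedgeShuffle.IsLocalPrivacyBudget n ε δ εL) :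
    (WedgeShuffle.ElementDP (WedgeShuffle.WShuffleSquare ht εL) ε δ ∧
      WedgeShuffle.EdgeDP (WedgeShuffle.WShuffleSquare ht εL) (2 * ε) (2 * δ)) ∧
    (WedgeShuffle.ElementDP (WedgeShuffle.collectorView (t := t) ht εL) ε δ ∧
      WedgeShuffle.EdgeDP (WedgeShuffle.collectorView (t := t) ht εL) (2 * ε) (2 * δ)) := by
  obtain ⟨hL, hbound⟩ := hεL
  have h : WedgeShuffle.IsNumericalBound (n - 2) ε δ εL :=
    hbound.elim (fun h => h.isNumericalBound (by omega) hδ1 hL) id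
  have hel := WedgeShuffle.elementDP_collectorView ht1 ht hε h
  have hed := WedgeShuffle.edgeDP_collectorView ht1 ht hε hδ0 h
  exact ⟨⟨fun A A' hA => (hel A A' hA).map _, fun G G' hG => (hed G G' hG).map _⟩, hel, hed⟩
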